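/- **Setting.** Let $r,s\ge 0$, let $\Delta=(v_1,\dots,v_n)$ be a tuple of vectors in $\mathbb Z^2\setminus\{0\}$ and let $F\subset\{1,\dots,n\}$ with $r+2s+|F|=n-1$. An $(r,s)$-marked curve of degree $\Delta$ is a connected rational plane tropical curve $(\Gamma,h)$: $\Gamma$ is a metric tree with vertices of valence at least $3$, with labelled unbounded edges $x_1,\dots,x_{r+s}$ (markings, contracted by $h$; $x_1,\dots,x_r$ are *real*, $x_{r+1},\dots,x_{r+s}$ *complex*) and $y_1,\dots,y_n$ (ends; $y_i$ has direction $v_i$), and $h:\Gamma\to\mathbb R^2$ is continuous, integer affine linear on edges and balanced at all vertices. Curves are taken up to isomorphism. The ends $y_i$ with $i\in F$ are called fixed, and $w(y_i)$ is the gcd of the entries of $v_i$. The evaluation map is $\mathrm{ev}(C)=\big((h(x_j))_j,(h(y_i))_{i\in F}\big)\in(\mathbb R^2)^{r+s}\times\prod_{i\in F}\mathbb R^2/\langle v_i\rangle$. The *Mikhalkin multiplicity* of a vertex with three adjacent unmarked edges is the absolute value of the determinant of the directions of two of them. Let $G(\Delta,F)$ be the group of permutations $\sigma$ of $\{1,\dots,n\}$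 with $\sigma(i)=i$ for $i\in F$ and $v_{\sigma(i)}=v_i$ for all $i$. A *refined descendant curve* is an $(r,s)$-marked curve in which every real marking is adjacent to a $3$-valent and every complex marking to a $4$-valent vertex. Let $M$ be the closure of the set of these curves in the moduli space. A tuple $\mathcal P=((P_j),(Q_i)_{i\in F})$ is in *general position* if it does not lie in $\mathrm{ev}(M^\tau)$ for any combinatorial type $\tau$ with $\dim\mathrm{ev}(M^\tau)<2(r+s)+|F|$. An *(unoriented) refined broccoli curve* is an $(r,s)$-marked curve all of whose vertices are (I') $3$-valent with exactly one marking, which is real, (II') $3$-valent without marking, or (III') $4$-valent with exactly one marking, which is complex. With $a$ the Mikhalkin multiplicity, put $m_V(y)=1$ for (I'), $m_V(y)=\frac{y^{a/2}-y^{-a/2}}{y^{1/2}-y^{-1/2}}$ for (II'), $m_V(y)=\frac{y^{a/2}+y^{-a/2}}{y^{1/2}+y^{-1/2}}$ for (III'). For an end of weight $w=w(y_i)$ put $$m_{y_i}(y)=\frac{y^{w/2}+(-1)^w y^{-w/2}}{y^{1/2}+(-1)^w y^{-1/2}}\ (i\in F),\qquad m_{y_i}(y)=\frac{y^{w/2}-(-1)^w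 y^{-w/2}}{w\,(y^{1/2}-(-1)^w y^{-1/2})}\ (i\notin F),$$ and let $m_C(y)=\prod_V m_V(y)\prod_i m_{y_i}(y)$. For $\mathcal P$ in general position let $$N^{desc}_{(r,s)}(y,\Delta,F,\mathcal P)=\frac1{|G(\Delta,F)|}\sum_C m_C(y),$$ the sum over all refined descendant curves $C$ with $\mathrm{ev}(C)=\mathcal P$ (these are refined broccoli curves), and let $N^{urB}_{(r,s)}(y,\Delta,F,\mathcal P)$ be the same expression summed over the refined broccoli curves with $\mathrm{ev}(C)=\mathcal P$. Let $\alpha_i$ be the number of $j\in F$ with $w(y_j)=i$, and let $I^\alpha=\prod_i i^{\alpha_i}$. The rational tropical descendant Gromov–Witten invariant, computed with the conditions $\mathcal P$, is $$\widetilde N^{\mathrm{trop}}_{\Delta,(r,s,0,\dots)}(\alpha)=\frac1{I^\alpha}\frac1{|G(\Delta,F)|}\sum_C\ \prod_{V}\operatorname{mult}(V),$$ the sum over all curves $C$ with $r+s$ markings with $\mathrm{ev}(C)=\mathcal P$ whose vertices without marking are all $3$-valent and for which $x_j$ is adjacent to a vertex of valence $3$ if $j\le r$ and of valence $4$ if $j>r$;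 the product is over the $3$-valent vertices $V$ without marking, and $\operatorname{mult}$ is the Mikhalkin multiplicity. **Lemma.** Let $\mathcal P$ be in general position. Then the set of refined descendant curves $C$ with $\mathrm{ev}(C)=\mathcal P$ is finite, the rational function $N^{desc}_{(r,s)}(y,\Delta,F,\mathcal P)$ of $y^{1/2}$ is regular at $y^{1/2}=1$, and $$N^{desc}_{(r,s)}(1,\Delta,F,\mathcal P)=\frac{\prod_{i\in O_f}w(y_i)}{\prod_{i\in O_n}w(y_i)}\; I^\alpha\;\widetilde N^{\mathrm{trop}}_{\Delta,(r,s,0,\dots)}(\alpha),$$ where $O_f=\{i\in F: w(y_i)\text{ odd}\}$ and $O_n=\{i\notin F: w(y_i)\text{ odd}\}$. The same holds for the refined broccoli invariant $N^{urB}_{(r,s)}(y,\Delta,F,\mathcal P)$ in place of $N^{desc}_{(r,s)}(y,\Delta,F,\mathcal P)$. -/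

import Mathlib

open scoped Classical

noncomputable section

namespace RefinedTropical

/-- An integral vector regarded as a vector of the real plane. -/
def toPlane (v : ℤ × ℤ) : ℝ × ℝ := ((v.1 : ℝ), (v.2 : ℝ))

/-- The weight of an integral direction vector: the gcd of its entries. -/
def weight (v : ℤ × ℤ) : ℕ := Int.gcd v.1 v.2

/-- A connected rational plane tropical curve `(Γ, h)` of degree `Δ = (v(y₁), …, v(yₙ))` with `m`
contracted marked ends `x₁, …, x_m`; all unbounded edges are labelled.

`Γ` is a metric tree: `graph` is the finite tree formed by the vertices and the bounded edges,
`len` gives the lengths of the bounded edges, and `endVertex i`, `markVertex j` are the vertices at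
which the unbounded edges `y_i`, `x_j` are attached. The map `h` is recorded by the images `pos v`
of the vertices and by the integral direction vectors `dir v w` of `h` on the bounded edges,
pointing from `v` to `w` (the values of `len` and `dir` off the bounded edges carry no meaning).
The unbounded edge `y_i` has outgoing direction `Δ i`, the marked ends `x_j` are mapped to points.
Bounded edges with direction vector zero are allowed. -/
structure MarkedCurve {n : ℕ} (Δ : Fin n → ℤ × ℤ) (m : ℕ) where
  /-- number of vertices of `Γ` -/
  card : ℕ
  graph : SimpleGraph (Fin card)
  endVertex : Fin n → Fin card
  markVertex : Fin m → Fin card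
  len : Sym2 (Fin card) → ℝ
  dir : Fin card → Fin card → ℤ × ℤ
  pos : Fin card → ℝ × ℝ
  isTree : graph.IsTree
  three_le_valence : ∀ v, 3 ≤ (Finset.univ.filter fun w => graph.Adj v w).card
    + (Finset.univ.filter fun i => endVertex i = v).card
    + (Finset.univ.filter fun j => markVertex j = v).card
  len_pos : ∀ e ∈ graph.edgeSet, 0 < len e
  /-- `h` is affine linear with integral direction vector on bounded edges -/
  affine : ∀ v w, graph.Adj v w → pos w - pos v = len s(v, w) • toPlane (dir v w)
  /-- the balancing condition -/
  balanced : ∀ v, ∑ w ∈ Finset.univ.filter (fun w => graph.Adj v w), dir v w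
    + ∑ i ∈ Finset.univ.filter (fun i => endVertex i = v), Δ i = 0

namespace MarkedCurve

variable {n : ℕ} {Δ : Fin n → ℤ × ℤ} {m : ℕ}

/-- The valence of a vertex of `Γ`; bounded edges, ends and markings all count. -/
def valence (C : MarkedCurve Δ m) (v : Fin C.card) : ℕ :=
  (Finset.univ.filter fun w => C.graph.Adj v w).card
    + (Finset.univ.filter fun i => C.endVertex i = v).card
    + (Finset.univ.filter fun j => C.markVertex j = v).card

/-- No marking is adjacent to the vertex `v`. -/
def Unmarked (C : MarkedCurve Δ m) (v : Fin C.card) : Prop := ∀ j, C.markVertex j ≠ v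

/-- Isomorphism of marked curves: an isomorphism of the underlying metric trees which respects all
labels and the maps to the plane. -/
def Isomorphic (C D : MarkedCurve Δ m) : Prop :=
  ∃ φ : C.graph ≃g D.graph,
    (∀ i, φ (C.endVertex i) = D.endVertex i) ∧
    (∀ j, φ (C.markVertex j) = D.markVertex j) ∧
    (∀ v w, C.graph.Adj v w → D.len s(φ v, φ w) = C.len s(v, w)) ∧
    (∀ v, D.pos (φ v) = C.pos v)

/-- Two marked curves have the same combinatorial type: they agree up to the lengths of the
bounded edges and the position in the plane. -/
def SameType (C D : MarkedCurve Δ m) : Prop :=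
  ∃ φ : C.graph ≃g D.graph,
    (∀ i, φ (C.endVertex i) = D.endVertex i) ∧
    (∀ j, φ (C.markVertex j) = D.markVertex j) ∧
    (∀ v w, C.graph.Adj v w → D.dir (φ v) (φ w) = C.dir v w)

/-- The combinatorial type of `C` arises from the one of `D` by contracting a set of bounded edges
(letting their lengths go to zero). Equivalently, `C` lies in the closure of the cell of the moduli
space that consists of the curves of the same combinatorial type as `D`. -/
def IsContractionOf (C D : MarkedCurve Δ m) : Prop :=
  ∃ f : Fin D.card → Fin C.card,
    (∀ i, f (D.endVertex i) = C.endVertex i) ∧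
    (∀ j, f (D.markVertex j) = C.markVertex j) ∧
    (∀ v, (D.graph.induce (f ⁻¹' {v})).Connected) ∧
    (∀ v w, D.graph.Adj v w →
      f v = f w ∨ (C.graph.Adj (f v) (f w) ∧ C.dir (f v) (f w) = D.dir v w)) ∧
    (∀ v w, C.graph.Adj v w → ∃ v' w', D.graph.Adj v' w' ∧ f v' = v ∧ f w' = w)

theorem isomorphic_equivalence : Equivalence (Isomorphic (Δ := Δ) (m := m)) where
  refl C := ⟨SimpleGraph.Iso.refl, fun _ => rfl, fun _ => rfl, fun _ _ _ => rfl, fun _ => rfl⟩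
  symm := by
    rintro C D ⟨φ, he, hm, hl, hp⟩
    refine ⟨φ.symm, fun i => ?_, fun j => ?_, fun v w h => ?_, fun v => ?_⟩
    · rw [← he i]; exact φ.symm_apply_apply _
    · rw [← hm j]; exact φ.symm_apply_apply _
    · have := hl (φ.symm v) (φ.symm w) (φ.symm.map_rel_iff.2 h)
      rw [← this]
      congr 2 <;> simp
    · rw [← hp]
      congr 1
      simp
  trans := by
    rintro C D E ⟨φ, he, hm, hl, hp⟩ ⟨ψ, he', hm', hl', hp'⟩
    refine ⟨φ.trans ψ, fun i => ?_, fun j => ?_, fun v w h => ?_, fun v => ?_⟩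
    · rw [← he', ← he]; rfl
    · rw [← hm', ← hm]; rfl
    · rw [← hl v w h, ← hl' _ _ (φ.map_rel_iff.2 h)]; rfl
    · rw [← hp, ← hp']; rfl

/-- The unmarked edges of `Γ` adjacent to the vertex `v`: bounded edges, named by their other
vertex, and unbounded edges `y_i`, named by their index. -/
def unmarkedEdges (C : MarkedCurve Δ m) (v : Fin C.card) : Finset (Fin C.card ⊕ Fin n) :=
  Finset.univ.filter (Sum.elim (fun w => C.graph.Adj v w) (fun i => C.endVertex i = v))

/-- The direction vectors, pointing away from `v`, of the unmarked edges adjacent to `v`. -/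
def outDir (C : MarkedCurve Δ m) (v : Fin C.card) : Fin C.card ⊕ Fin n → ℤ × ℤ :=
  Sum.elim (fun w => C.dir v w) Δ

/-- The Mikhalkin multiplicity of a vertex with three adjacent unmarked edges: the absolute value
of the determinant of the direction vectors of two of these edges. By the balancing condition any
two different edges give the same value (and equal ones give zero), so that the maximum over all
pairs is this value. -/
def mikhalkinMult (C : MarkedCurve Δ m) (v : Fin C.card) : ℕ :=
  (C.unmarkedEdges v ×ˢ C.unmarkedEdges v).sup fun e =>
    ((C.outDir v e.1).1 * (C.outDir v e.2).2 - (C.outDir v e.1).2 * (C.outDir v e.2).1).natAbs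

end MarkedCurve

/-- Isomorphism of marked curves as a setoid. -/
def isoSetoid {n : ℕ} (Δ : Fin n → ℤ × ℤ) (m : ℕ) : Setoid (MarkedCurve Δ m) :=
  ⟨MarkedCurve.Isomorphic, MarkedCurve.isomorphic_equivalence⟩

/-- The moduli space of connected marked curves of degree `Δ`: the set of isomorphism classes. -/
def Moduli {n : ℕ} (Δ : Fin n → ℤ × ℤ) (m : ℕ) : Type := Quotient (isoSetoid Δ m)

/-- A curve in a given isomorphism class. Everything below that is evaluated at it depends on the
isomorphism class only. -/
def Moduli.rep {n : ℕ} {Δ : Fin n → ℤ × ℤ} {m : ℕ} (c : Moduli Δ m) : MarkedCurve Δ m :=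
  Quotient.out c

section Conditions

variable {n : ℕ} (Δ : Fin n → ℤ × ℤ) (F : Finset (Fin n)) (m : ℕ)

/-- Collections of conditions `((P_j), (Q_i : i ∈ F))`: points `P_j` in the plane for the markings
and lines `Q_i ∈ ℝ² / ⟨v(y_i)⟩` for the fixed ends. -/
abbrev Conditions : Type :=
  (Fin m → ℝ × ℝ) × (∀ i : {i // i ∈ F}, (ℝ × ℝ) ⧸ Submodule.span ℝ {toPlane (Δ i.1)})

variable {Δ m}

/-- The evaluation map with respect to the set `F` of fixed ends. -/
def ev (C : MarkedCurve Δ m) : Conditions Δ F m :=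
  (fun j => C.pos (C.markVertex j),
    fun i => Submodule.Quotient.mk (C.pos (C.endVertex i.1)))

/-- Conditions in general position for the evaluation map on a union `M` of cells of the moduli
space: they do not lie in the image of a cell of `M` (the set of curves of `M` of one combinatorial
type) whose image has dimension at most `2 m + |F| - 1`. The images are convex, and their dimension
is the one of their affine span. -/
def InGeneralPosition (M : Set (MarkedCurve Δ m)) (P : Conditions Δ F m) : Prop :=
  ∀ C ∈ M,
    Module.finrank ℝ (vectorSpan ℝ (ev F '' {D | D ∈ M ∧ C.SameType D})) < 2 * m + F.card →
    P ∉ ev F '' {D | D ∈ M ∧ C.SameType D}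

variable (Δ)

/-- The group `G(Δ, F)` of all permutations of the labels of the ends which fix every index in `F`
and preserve all direction vectors. -/
def labelGroup : Subgroup (Equiv.Perm (Fin n)) where
  carrier := {σ | (∀ i ∈ F, σ i = i) ∧ ∀ i, Δ (σ i) = Δ i}
  mul_mem' := by
    rintro σ τ ⟨h1, h2⟩ ⟨h3, h4⟩
    exact ⟨fun i hi => by simp [h3 i hi, h1 i hi], fun i => by simp [h2, h4]⟩
  one_mem' := by simp
  inv_mem' := by
    rintro σ ⟨h1, h2⟩
    refine ⟨fun i hi => ?_, fun i => ?_⟩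
    · rw [Equiv.Perm.inv_eq_iff_eq]; exact (h1 i hi).symm
    · rw [← h2 (σ⁻¹ i)]; simp

/-- The sequence `α`: `α_i` is the number of fixed ends of weight `i`. -/
def fixedWeights (i : ℕ) : ℕ := (F.filter fun j => weight (Δ j) = i).card

end Conditions

/-- `I^α = ∏ i ^ α_i` for a sequence `α` with finitely many non-zero entries. -/
def weightPow (α : ℕ → ℕ) : ℕ := ∏ᶠ i, i ^ α i

section TropicalDescendant

variable {n : ℕ} (Δ : Fin n → ℤ × ℤ) (F : Finset (Fin n)) {m : ℕ}

/-- The multiplicity of a curve in the count of tropical descendant invariants: the product of the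
Mikhalkin multiplicities of all 3-valent vertices which are not adjacent to a marking. -/
def MarkedCurve.descMult {Δ : Fin n → ℤ × ℤ} (C : MarkedCurve Δ m) : ℕ :=
  ∏ v ∈ Finset.univ.filter (fun v => C.valence v = 3 ∧ C.Unmarked v), C.mikhalkinMult v

/-- The curves counted by tropical descendant invariants: vertices without adjacent marking are
3-valent, and the marking `x_j` is adjacent to a vertex of valence `a_j + 3`. -/
def MarkedCurve.IsDescendant {Δ : Fin n → ℤ × ℤ} (a : Fin m → ℕ) (C : MarkedCurve Δ m) : Prop :=
  (∀ v, C.Unmarked v → C.valence v = 3) ∧ ∀ j, C.valence (C.markVertex j) = a j + 3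

/-- The rational tropical descendant Gromov-Witten invariant `Ñ^trop_{Δ,𝐤}(α)`, computed with the
conditions `P`. Here `𝐤 = (k₀, k₁, …)` is given by the vector `a` which contains `i` exactly
`k_i` times, and `α` by the set `F` of fixed ends. -/
def tropDescendantInvariant (a : Fin m → ℕ) (P : Conditions Δ F m) : ℚ :=
  1 / (weightPow (fixedWeights Δ F) : ℚ) * (1 / (Nat.card (labelGroup Δ F) : ℚ)) *
    ∑ᶠ c ∈ {c : Moduli Δ m | c.rep.IsDescendant a ∧ ev F c.rep = P}, (c.rep.descMult : ℚ)

end TropicalDescendant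

section Refined

/-! Refined multiplicities are rational functions in `t = y^{1/2}`. -/

/-- The variable `t = y^{1/2}`. -/
abbrev t : RatFunc ℚ := RatFunc.X

/-- The rational function `f` in `t = y^{1/2}` is regular at `y^{1/2} = 1` with value `q`. -/
def HasValueAtOne (f : RatFunc ℚ) (q : ℚ) : Prop :=
  f.denom.eval 1 ≠ 0 ∧ f.eval (RingHom.id ℚ) 1 = q

variable {n r s : ℕ} {Δ : Fin n → ℤ × ℤ}

/-! An `(r,s)`-marked curve is a curve with `r + s` markings. The first `r` of them,
`Fin.castAdd s i`, are real and the last `s` of them, `Fin.natAdd r j`, are complex. -/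

/-- Vertex type (I'): a 3-valent vertex with exactly one marking, which is real. -/
def IsTypeI (C : MarkedCurve Δ (r + s)) (v : Fin C.card) : Prop :=
  C.valence v = 3 ∧ (∃! j, C.markVertex j = v) ∧ ∃ i : Fin r, C.markVertex (Fin.castAdd s i) = v

/-- Vertex type (II'): a 3-valent vertex without marking. -/
def IsTypeII (C : MarkedCurve Δ (r + s)) (v : Fin C.card) : Prop :=
  C.valence v = 3 ∧ C.Unmarked v

/-- Vertex type (III'): a 4-valent vertex with exactly one marking, which is complex. -/
def IsTypeIII (C : MarkedCurve Δ (r + s)) (v : Fin C.card) : Prop :=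
  C.valence v = 4 ∧ (∃! j, C.markVertex j = v) ∧ ∃ i : Fin s, C.markVertex (Fin.natAdd r i) = v

/-- Unoriented refined broccoli curves. -/
def IsRefinedBroccoli (C : MarkedCurve Δ (r + s)) : Prop :=
  ∀ v, IsTypeI C v ∨ IsTypeII C v ∨ IsTypeIII C v

/-- Refined descendant curves: real markings are adjacent to 3-valent vertices and complex markings
are adjacent to 4-valent vertices. -/
def IsRefinedDescendant (C : MarkedCurve Δ (r + s)) : Prop :=
  (∀ i : Fin r, C.valence (C.markVertex (Fin.castAdd s i)) = 3) ∧
    ∀ i : Fin s, C.valence (C.markVertex (Fin.natAdd r i)) = 4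

/-- The closure of the set of refined descendant curves in the moduli space. -/
def descComplex (r s : ℕ) (Δ : Fin n → ℤ × ℤ) : Set (MarkedCurve Δ (r + s)) :=
  {C | ∃ D : MarkedCurve Δ (r + s), IsRefinedDescendant D ∧ C.IsContractionOf D}

/-- The refined multiplicity of a vertex of an unoriented refined broccoli curve; it is `1` for
vertices of type (I'). (Vertices of none of the types (I'), (II'), (III') do not occur in refined
broccoli curves.) -/
def vertexMult (C : MarkedCurve Δ (r + s)) (v : Fin C.card) : RatFunc ℚ :=
  if IsTypeII C v then
    (t ^ C.mikhalkinMult v - t⁻¹ ^ C.mikhalkinMult v) / (t - t⁻¹)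
  else if IsTypeIII C v then
    (t ^ C.mikhalkinMult v + t⁻¹ ^ C.mikhalkinMult v) / (t + t⁻¹)
  else 1

/-- The refined multiplicity of an end of weight `w`; `fixed` tells whether the end is fixed. -/
def endMult (fixed : Prop) (w : ℕ) : RatFunc ℚ :=
  if fixed then (t ^ w + (-1) ^ w * t⁻¹ ^ w) / (t + (-1) ^ w * t⁻¹)
  else (t ^ w - (-1) ^ w * t⁻¹ ^ w) / ((w : RatFunc ℚ) * (t - (-1) ^ w * t⁻¹))

/-- The refined multiplicity `m_{C,F}(y)` of a curve. -/
def refinedMult (F : Finset (Fin n)) (C : MarkedCurve Δ (r + s)) : RatFunc ℚ :=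
  (∏ v, vertexMult C v) * ∏ i, endMult (i ∈ F) (weight (Δ i))

/-- The tropical refined descendant invariant `N^desc_{(r,s)}(y, Δ, F, P)`. -/
def refinedDescendantInvariant (r s : ℕ) (Δ : Fin n → ℤ × ℤ) (F : Finset (Fin n))
    (P : Conditions Δ F (r + s)) : RatFunc ℚ :=
  1 / (Nat.card (labelGroup Δ F) : RatFunc ℚ) *
    ∑ᶠ c ∈ {c : Moduli Δ (r + s) | IsRefinedDescendant c.rep ∧ ev F c.rep = P}, refinedMult F c.rep

/-- The (unoriented) refined broccoli invariant `N^urB_{(r,s)}(y, Δ, F, P)`. -/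
def refinedBroccoliInvariant (r s : ℕ) (Δ : Fin n → ℤ × ℤ) (F : Finset (Fin n))
    (P : Conditions Δ F (r + s)) : RatFunc ℚ :=
  1 / (Nat.card (labelGroup Δ F) : RatFunc ℚ) *
    ∑ᶠ c ∈ {c : Moduli Δ (r + s) | IsRefinedBroccoli c.rep ∧ ev F c.rep = P}, refinedMult F c.rep

end Refined

end RefinedTropical

end

/-! Both counts run over the same finite set of curves, and at `t = 1` their multiplicities differ
by a factor common to all curves.

Let `E` be the number of bounded edges of a refined descendant curve through `P`. General position
forces evaluation on its cell to have full rank `2(r+s) + |F|`, while the cell has at most `2 + E`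
parameters. Full rank puts the markings at distinct vertices. Every valence is at least 3, and 4 at
the complex markings, so counting flags of a tree gives `2 + E ≤ 2(r+s) + |F|`. Hence all these
bounds are equalities. Every unmarked vertex is therefore 3-valent, which identifies refined
descendant, refined broccoli and tropical descendant curves through `P`
(`setOf_isRefinedBroccoli_eq`, `setOf_isDescendant_eq`). Evaluation is also injective on each cell,
so each combinatorial type contributes at most one curve. There are finitely many types because
balancing recovers all directions from the labelled tree (`dir_eq_of_iso`).

At `t = 1` a quotient of differences `(t^a - t^(-a)) / (t - t^(-1))` takes the value `a` and a
quotient of sums takes the value 1. Vertices thus give the Mikhalkin multiplicities, and only ends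
of odd weight contribute: `w` if fixed, `1/w` otherwise (`hasValueAtOne_refinedMult`). -/

namespace RefinedTropical

/-! ### Regularity and values of rational functions at `t = 1`. -/

section ValueAtOne

open Polynomial

/-- The reduced denominator divides any polynomial `q` that clears denominators, so it cannot vanish
at 1 if `q` does not. This reduces regularity to exhibiting `p` and `q`. -/
theorem HasValueAtOne.of_mul_eq {f : RatFunc ℚ} {p q : ℚ[X]} (hq : q.eval 1 ≠ 0)
    (h : f * algebraMap ℚ[X] (RatFunc ℚ) q = algebraMap ℚ[X] (RatFunc ℚ) p) :
    HasValueAtOne f (p.eval 1 / q.eval 1) := by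
  have hq0 : algebraMap ℚ[X] (RatFunc ℚ) q ≠ 0 := by
    rw [Ne, FaithfulSMul.algebraMap_eq_zero_iff]
    rintro rfl
    simp at hq
  obtain ⟨k, hk⟩ : f.denom ∣ q := by
    rw [eq_div_of_mul_eq hq0 h]
    exact RatFunc.denom_div_dvd p q
  have hd : f.denom.eval 1 ≠ 0 := by
    intro h0
    rw [hk, eval_mul, h0, zero_mul] at hq
    exact hq rfl
  refine ⟨hd, ?_⟩
  rw [eq_div_iff hq]
  have h1 := RatFunc.eval_mul (RingHom.id ℚ) (1 : ℚ) (x := f) (y := algebraMap ℚ[X] (RatFunc ℚ) q)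
    hd (by simp)
  rw [h] at h1
  simpa using h1.symm

theorem HasValueAtOne.mul {f g : RatFunc ℚ} {a b : ℚ} (hf : HasValueAtOne f a)
    (hg : HasValueAtOne g b) : HasValueAtOne (f * g) (a * b) := by
  refine ⟨fun h => ?_, ?_⟩
  · have := eval_dvd (x := (1 : ℚ)) (RatFunc.denom_mul_dvd f g)
    rw [h, zero_dvd_iff, eval_mul] at this
    exact mul_ne_zero hf.1 hg.1 this
  · rw [RatFunc.eval_mul (RingHom.id ℚ) (1 : ℚ) hf.1 hg.1, hf.2, hg.2]

theorem HasValueAtOne.add {f g : RatFunc ℚ} {a b : ℚ} (hf : HasValueAtOne f a)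
    (hg : HasValueAtOne g b) : HasValueAtOne (f + g) (a + b) := by
  refine ⟨fun h => ?_, ?_⟩
  · have := eval_dvd (x := (1 : ℚ)) (RatFunc.denom_add_dvd f g)
    rw [h, zero_dvd_iff, eval_mul] at this
    exact mul_ne_zero hf.1 hg.1 this
  · rw [RatFunc.eval_add (RingHom.id ℚ) (1 : ℚ) hf.1 hg.1, hf.2, hg.2]

theorem hasValueAtOne_zero : HasValueAtOne 0 0 := by
  simpa using HasValueAtOne.of_mul_eq (f := 0) (p := 0) (q := 1) (by simp) (by simp)

theorem hasValueAtOne_one : HasValueAtOne 1 1 := by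
  simpa using HasValueAtOne.of_mul_eq (f := 1) (p := 1) (q := 1) (by simp) (by simp)

theorem hasValueAtOne_one_div_natCast {k : ℕ} (hk : k ≠ 0) :
    HasValueAtOne (1 / (k : RatFunc ℚ)) (1 / (k : ℚ)) := by
  have hk' : (k : RatFunc ℚ) ≠ 0 := Nat.cast_ne_zero.2 hk
  simpa using HasValueAtOne.of_mul_eq (f := 1 / (k : RatFunc ℚ)) (p := 1) (q := (k : ℚ[X]))
    (by simpa using hk) (by simp [hk'])

theorem HasValueAtOne.prod {ι : Type*} (S : Finset ι) {f : ι → RatFunc ℚ} {a : ι → ℚ}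
    (h : ∀ i ∈ S, HasValueAtOne (f i) (a i)) : HasValueAtOne (∏ i ∈ S, f i) (∏ i ∈ S, a i) := by
  induction S using Finset.induction_on with
  | empty => simpa using hasValueAtOne_one
  | insert i S hi ih =>
    rw [Finset.prod_insert hi, Finset.prod_insert hi]
    exact (h i (Finset.mem_insert_self i S)).mul
      (ih fun j hj => h j (Finset.mem_insert_of_mem hj))

theorem HasValueAtOne.sum {ι : Type*} (S : Finset ι) {f : ι → RatFunc ℚ} {a : ι → ℚ}
    (h : ∀ i ∈ S, HasValueAtOne (f i) (a i)) : HasValueAtOne (∑ i ∈ S, f i) (∑ i ∈ S, a i) := by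
  induction S using Finset.induction_on with
  | empty => simpa using hasValueAtOne_zero
  | insert i S hi ih =>
    rw [Finset.sum_insert hi, Finset.sum_insert hi]
    exact (h i (Finset.mem_insert_self i S)).add
      (ih fun j hj => h j (Finset.mem_insert_of_mem hj))

theorem t_ne_zero : t ≠ 0 := RatFunc.X_ne_zero

theorem t_sq_sub_one_ne_zero : t ^ 2 - 1 ≠ 0 := by
  have h : (X ^ 2 - 1 : ℚ[X]) ≠ 0 := (monic_X_pow_sub_C (1 : ℚ) two_ne_zero).ne_zero
  simpa using (FaithfulSMul.algebraMap_eq_zero_iff ℚ[X] (RatFunc ℚ)).not.2 h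

theorem t_sq_add_one_ne_zero : t ^ 2 + 1 ≠ 0 := by
  have h : (X ^ 2 + 1 : ℚ[X]) ≠ 0 := (monic_X_pow_add_C (1 : ℚ) two_ne_zero).ne_zero
  simpa using (FaithfulSMul.algebraMap_eq_zero_iff ℚ[X] (RatFunc ℚ)).not.2 h

theorem hasValueAtOne_sub_div_sub (a : ℕ) :
    HasValueAtOne ((t ^ a - t⁻¹ ^ a) / (t - t⁻¹)) a := by
  -- The singularity at 1 is removable: the factor `t^2 - 1` cancels against `t^(2a) - 1`, leaving a
  -- geometric sum with `a` terms.
  have h := HasValueAtOne.of_mul_eq (f := (t ^ a - t⁻¹ ^ a) / (t - t⁻¹))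
    (p := X * ∑ i ∈ Finset.range a, (X ^ 2) ^ i) (q := X ^ a) (by simp) ?_
  · simpa [eval_finsetSum] using h
  · have ht := t_ne_zero
    have h2 := t_sq_sub_one_ne_zero
    have h3 : t - t⁻¹ = (t ^ 2 - 1) / t := by field_simp
    have h4 := geom_sum_mul (t ^ 2) a
    simp only [map_mul, map_sum, map_pow, RatFunc.algebraMap_X]
    rw [h3]
    have h5 : ∑ i ∈ Finset.range a, (t ^ 2) ^ i = ((t ^ 2) ^ a - 1) / (t ^ 2 - 1) :=
      eq_div_of_mul_eq h2 h4
    rw [h5, inv_pow]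
    field_simp
    ring

theorem hasValueAtOne_add_div_add (a : ℕ) :
    HasValueAtOne ((t ^ a + t⁻¹ ^ a) / (t + t⁻¹)) 1 := by
  have h := HasValueAtOne.of_mul_eq (f := (t ^ a + t⁻¹ ^ a) / (t + t⁻¹))
    (p := X * (X ^ (2 * a) + 1)) (q := X ^ a * (X ^ 2 + 1)) (by norm_num) ?_
  · norm_num at h
    rwa [inv_pow]
  · have ht := t_ne_zero
    have h2 := t_sq_add_one_ne_zero
    have h3 : t + t⁻¹ = (t ^ 2 + 1) / t := by field_simp
    simp only [map_mul, map_add, map_one, map_pow, RatFunc.algebraMap_X]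
    rw [h3, inv_pow]
    field_simp
    ring

theorem hasValueAtOne_endMult_fixed {p : Prop} (hp : p) (w : ℕ) :
    HasValueAtOne (endMult p w) (if Odd w then w else 1) := by
  rw [endMult, if_pos hp]
  split_ifs with hw
  · simpa [hw.neg_one_pow, sub_eq_add_neg] using hasValueAtOne_sub_div_sub w
  · simpa [(Nat.not_odd_iff_even.1 hw).neg_one_pow] using hasValueAtOne_add_div_add w

theorem hasValueAtOne_endMult_free {p : Prop} (hp : ¬ p) {w : ℕ} (hw0 : w ≠ 0) :
    HasValueAtOne (endMult p w) (if Odd w then (w : ℚ)⁻¹ else 1) := by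
  have hw0' : (w : ℚ) ≠ 0 := Nat.cast_ne_zero.2 hw0
  rw [endMult, if_neg hp]
  -- The sign `(-1)^w` selects the type of quotient. For free ends, odd `w` gives a quotient of sums
  -- and only the prefactor `1/w` survives. Even `w` gives a quotient of differences, whose value
  -- `w` cancels it.
  split_ifs with hw
  · have := (hasValueAtOne_one_div_natCast hw0).mul (hasValueAtOne_add_div_add w)
    simpa [hw.neg_one_pow, div_eq_mul_inv, mul_comm, mul_left_comm, mul_assoc] using this
  · have := (hasValueAtOne_one_div_natCast hw0).mul (hasValueAtOne_sub_div_sub w)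
    simpa [(Nat.not_odd_iff_even.1 hw).neg_one_pow, div_eq_mul_inv, mul_comm, mul_left_comm,
      mul_assoc, hw0'] using this

end ValueAtOne

/-! ### Flows on trees, valence counts and the dimension of the space of conditions. -/

/-- A flow without sources and sinks on the edges of a finite tree vanishes. -/
theorem _root_.SimpleGraph.IsTree.flow_eq_zero {V A : Type*} [Fintype V] [AddCommGroup A]
    {G : SimpleGraph V} (hG : G.IsTree) (δ : V → V → A)
    (hanti : ∀ v w, G.Adj v w → δ w v = -δ v w)
    (hsum : ∀ v, ∑ w ∈ Finset.univ.filter (fun w => G.Adj v w), δ v w = 0)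
    {a b : V} (hab : G.Adj a b) : δ a b = 0 := by
  set d : V → V → A := fun v w => if G.Adj v w then δ v w else 0 with hd
  have hd' : ∀ v w, d w v = -d v w := by
    intro v w
    simp only [hd, G.adj_comm w v]
    split_ifs with h
    · exact hanti v w h
    · simp
  -- Deleting the bridge `ab` cuts the tree in two. Conservation is summed over the side `S` of `a`:
  -- edges inside `S` cancel by antisymmetry, and `ab` is the only edge leaving `S`.
  set G' := G.deleteEdges {s(a, b)} with hG'
  have hbr : ¬ G'.Reachable a b :=
    SimpleGraph.isBridge_iff.1 (SimpleGraph.isAcyclic_iff_forall_adj_isBridge.1 hG.2 hab)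
  set S : Finset V := Finset.univ.filter fun v => G'.Reachable a v with hS
  have htot : ∑ v ∈ S, ∑ w, d v w = 0 := by
    refine Finset.sum_eq_zero fun v _ => ?_
    rw [← hsum v, Finset.sum_filter]
  have hcross : ∀ v ∈ S, ∀ w ∈ Sᶜ, ¬ (v = a ∧ w = b) → d v w = 0 := by
    intro v hv w hw hvw
    simp only [hS, Finset.mem_filter, Finset.mem_univ, true_and, Finset.mem_compl] at hv hw
    simp only [hd]
    rw [if_neg]
    intro hadj
    refine hw (hv.trans (SimpleGraph.Adj.reachable ?_))
    rw [hG', SimpleGraph.deleteEdges_adj]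
    refine ⟨hadj, ?_⟩
    rw [Set.mem_singleton_iff, Sym2.eq_iff]
    rintro (h | ⟨rfl, rfl⟩)
    · exact hvw h
    · exact hw (SimpleGraph.Reachable.refl _)
  have haS : a ∈ S := by simp [hS]
  have hbS : b ∈ Sᶜ := by simpa [hS] using hbr
  have hin : ∑ v ∈ S, ∑ w ∈ S, d v w = 0 := by
    rw [← Finset.sum_product']
    -- Swapping the two vertices negates each term. Fixed points lie on the diagonal, where `d` is
    -- zero for lack of loops.
    refine Finset.sum_involution (fun p _ => (p.2, p.1)) ?_ ?_ ?_ ?_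
    · rintro ⟨v, w⟩ _
      simp [hd' v w]
    · rintro ⟨v, w⟩ _ h heq
      simp only [Prod.mk.injEq] at heq
      obtain ⟨rfl, -⟩ := heq
      simp [hd] at h
    · rintro ⟨v, w⟩ h
      simpa [and_comm] using h
    · simp
  have hout : ∑ v ∈ S, ∑ w ∈ Sᶜ, d v w = d a b := by
    rw [Finset.sum_eq_single_of_mem a haS, Finset.sum_eq_single_of_mem b hbS]
    · exact fun w hw hwb => hcross a haS w hw (by simp [hwb])
    · exact fun v hv hva => Finset.sum_eq_zero fun w hw => hcross v hv w hw (by simp [hva])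
  have : d a b = 0 := by
    rw [← htot, ← hout, ← zero_add (∑ v ∈ S, ∑ w ∈ Sᶜ, d v w)]
    nth_rewrite 1 [← hin]
    rw [← Finset.sum_add_distrib]
    exact Finset.sum_congr rfl fun v _ => Finset.sum_add_sum_compl S _
  simpa [hd, hab] using this

namespace MarkedCurve

variable {n m : ℕ} {Δ : Fin n → ℤ × ℤ}

theorem sum_valence (C : MarkedCurve Δ m) :
    ∑ v, C.valence v = 2 * C.graph.edgeFinset.card + n + m := by
  have h1 : ∑ v, (Finset.univ.filter fun w => C.graph.Adj v w).card
      = 2 * C.graph.edgeFinset.card := by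
    rw [← C.graph.sum_degrees_eq_twice_card_edges]
    refine Finset.sum_congr rfl fun v _ => ?_
    rw [← SimpleGraph.card_neighborFinset_eq_degree, SimpleGraph.neighborFinset_eq_filter]
  have h2 : ∑ v, (Finset.univ.filter fun i => C.endVertex i = v).card = n := by
    rw [← Finset.card_eq_sum_card_fiberwise (f := C.endVertex) (s := Finset.univ) (by simp)]
    simp
  have h3 : ∑ v, (Finset.univ.filter fun j => C.markVertex j = v).card = m := by
    rw [← Finset.card_eq_sum_card_fiberwise (f := C.markVertex) (s := Finset.univ) (by simp)]
    simp
  simp only [valence, Finset.sum_add_distrib, h1, h2, h3]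

theorem card_edgeFinset_add_one (C : MarkedCurve Δ m) :
    C.graph.edgeFinset.card + 1 = C.card := by
  simpa using C.isTree.card_edgeFinset

theorem card_le (C : MarkedCurve Δ m) : C.card ≤ n + m := by
  have h1 : ∑ _v : Fin C.card, 3 ≤ ∑ v, C.valence v :=
    Finset.sum_le_sum fun v _ => C.three_le_valence v
  have h2 := C.sum_valence
  have h3 := C.card_edgeFinset_add_one
  simp at h1
  omega

end MarkedCurve

theorem toPlane_ne_zero {v : ℤ × ℤ} (hv : v ≠ 0) : toPlane v ≠ 0 := by
  contrapose! hv
  simpa [toPlane, Prod.ext_iff] using hv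

theorem toPlane_injective : Function.Injective toPlane := by
  rintro ⟨a, b⟩ ⟨c, d⟩ h
  simpa [toPlane] using h

theorem weight_ne_zero {v : ℤ × ℤ} (hv : v ≠ 0) : weight v ≠ 0 := by
  contrapose! hv
  simpa [weight, Int.gcd_eq_zero_iff, Prod.ext_iff] using hv

theorem finrank_conditions {n : ℕ} {Δ : Fin n → ℤ × ℤ} (hΔ : ∀ i, Δ i ≠ 0) (F : Finset (Fin n))
    (m : ℕ) : Module.finrank ℝ (Conditions Δ F m) = 2 * m + F.card := by
  have hq : ∀ i : {i // i ∈ F},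
      Module.finrank ℝ ((ℝ × ℝ) ⧸ Submodule.span ℝ {toPlane (Δ i.1)}) = 1 := by
    intro i
    have h1 := Submodule.finrank_quotient_add_finrank (Submodule.span ℝ {toPlane (Δ i.1)})
    rw [finrank_span_singleton (toPlane_ne_zero (hΔ i.1))] at h1
    simp at h1
    omega
  rw [Module.finrank_prod, Module.finrank_pi_fintype, Module.finrank_pi_fintype]
  simp [hq]
  ring

/-! ### Linear deformations of a combinatorial type and the evaluation map. -/

namespace MarkedCurve

variable {n m : ℕ} {Δ : Fin n → ℤ × ℤ}

/-- Antisymmetry is not part of the structure. It follows from the affine condition read in both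
directions, since the length is nonzero. -/
theorem dir_symm (C : MarkedCurve Δ m) {v w : Fin C.card} (h : C.graph.Adj v w) :
    C.dir w v = -C.dir v w := by
  have h1 := C.affine v w h
  have h2 := C.affine w v h.symm
  have hl : C.len s(v, w) ≠ 0 := (C.len_pos _ h).ne'
  rw [Sym2.eq_swap] at h2
  have h3 : C.len s(v, w) • (toPlane (C.dir w v) + toPlane (C.dir v w)) = 0 := by
    rw [smul_add, ← h1, ← h2]
    abel
  have h4 := (smul_eq_zero.1 h3).resolve_left hl
  have h5 : toPlane (C.dir w v + C.dir v w) = 0 := by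
    simpa [toPlane] using h4
  rw [eq_neg_iff_add_eq_zero]
  exact toPlane_injective (h5.trans (by simp [toPlane, Prod.ext_iff]))

/-- The directions of the bounded edges are determined by the labelled tree and the degree. -/
theorem dir_eq_of_iso {C D : MarkedCurve Δ m} (φ : C.graph ≃g D.graph)
    (hφ : ∀ i, φ (C.endVertex i) = D.endVertex i) {v w : Fin C.card} (h : C.graph.Adj v w) :
    D.dir (φ v) (φ w) = C.dir v w := by
  rw [← sub_eq_zero]
  -- The ends contribute the same vectors to both balancing conditions, so the difference of the two
  -- direction fields is a flow without sources.
  refine C.isTree.flow_eq_zero (fun v w => D.dir (φ v) (φ w) - C.dir v w) ?_ ?_ h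
  · intro v w hvw
    simp only [C.dir_symm hvw, D.dir_symm (φ.map_rel_iff.2 hvw)]
    abel
  · intro v
    have h1 := C.balanced v
    have h2 := D.balanced (φ v)
    have h3 : ∑ w ∈ Finset.univ.filter (fun w => D.graph.Adj (φ v) w), D.dir (φ v) w
        = ∑ w ∈ Finset.univ.filter (fun w => C.graph.Adj v w), D.dir (φ v) (φ w) := by
      rw [Finset.sum_filter, Finset.sum_filter, ← φ.toEquiv.sum_comp]
      exact Finset.sum_congr rfl fun w _ => if_congr φ.map_rel_iff rfl rfl
    have h4 : (Finset.univ.filter fun i => D.endVertex i = φ v)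
        = Finset.univ.filter fun i => C.endVertex i = v := by
      ext i
      simp [← hφ]
    rw [h3, h4] at h2
    rw [Finset.sum_sub_distrib, sub_eq_zero]
    exact add_right_cancel (h2.trans h1.symm)

/-- The space of all vertex positions and edge lengths of arbitrary sign which are compatible with
the combinatorial type of `C`. -/
def deformations (C : MarkedCurve Δ m) :
    Submodule ℝ ((Fin C.card → ℝ × ℝ) × (C.graph.edgeSet → ℝ)) where
  carrier := {x | ∀ v w (h : C.graph.Adj v w),
    x.1 w - x.1 v = x.2 ⟨s(v, w), h⟩ • toPlane (C.dir v w)}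
  add_mem' := by
    intro x y hx hy v w h
    simp only [Prod.fst_add, Prod.snd_add, Pi.add_apply, add_smul, ← hx v w h, ← hy v w h]
    abel
  zero_mem' := by simp
  smul_mem' := by
    intro c x hx v w h
    simp only [Prod.smul_fst, Prod.smul_snd, Pi.smul_apply, smul_assoc, ← hx v w h, smul_sub]

theorem mem_deformations {C : MarkedCurve Δ m}
    {x : (Fin C.card → ℝ × ℝ) × (C.graph.edgeSet → ℝ)} :
    x ∈ C.deformations ↔ ∀ v w (h : C.graph.Adj v w),
      x.1 w - x.1 v = x.2 ⟨s(v, w), h⟩ • toPlane (C.dir v w) := Iff.rfl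

/-- A deformation is determined by the position of one vertex and the lengths of all edges. -/
theorem finrank_deformations_le (C : MarkedCurve Δ m) :
    Module.finrank ℝ C.deformations ≤ 2 + C.graph.edgeFinset.card := by
  obtain ⟨o⟩ := C.isTree.1.nonempty
  let f : C.deformations →ₗ[ℝ] (ℝ × ℝ) × (C.graph.edgeSet → ℝ) :=
    (LinearMap.prodMap (LinearMap.proj o) LinearMap.id).comp C.deformations.subtype
  have hf : Function.Injective f := by
    rw [← LinearMap.ker_eq_bot, LinearMap.ker_eq_bot']
    rintro ⟨⟨p, l⟩, hx⟩ h0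
    obtain ⟨h1, h2⟩ : p o = 0 ∧ l = 0 := by simpa [f] using h0
    clear h0
    rw [mem_deformations] at hx
    -- With all lengths zero the position is constant along any walk to `o`.
    have hp : ∀ v, p v = 0 := by
      intro v
      obtain ⟨W⟩ := C.isTree.1.preconnected v o
      clear f
      induction W with
      | nil => exact h1
      | cons h _ ih =>
        have h3 := hx _ _ h
        simpa [h2, ih h1] using h3
    exact Subtype.ext (Prod.ext (funext hp) h2)
  refine (LinearMap.finrank_le_finrank_of_injective hf).trans ?_
  rw [Module.finrank_prod, Module.finrank_prod, Module.finrank_pi, ← SimpleGraph.edgeFinset_card]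
  simp

/-- The evaluation map on the deformations of `C`. -/
def evalDeformations (F : Finset (Fin n)) (C : MarkedCurve Δ m) :
    C.deformations →ₗ[ℝ] Conditions Δ F m where
  toFun x := (fun j => x.1.1 (C.markVertex j),
    fun i => Submodule.Quotient.mk (x.1.1 (C.endVertex i.1)))
  map_add' _ _ := rfl
  map_smul' _ _ := rfl

/-- The deformation of `C` given by a curve of the same combinatorial type. -/
def toDeformation {C D : MarkedCurve Δ m} (φ : C.graph ≃g D.graph)
    (hφ : ∀ v w, C.graph.Adj v w → D.dir (φ v) (φ w) = C.dir v w) : C.deformations :=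
  ⟨(fun v => D.pos (φ v), fun e => D.len (e.1.map φ)), fun v w h => by
    rw [← hφ v w h]
    exact D.affine _ _ (φ.map_rel_iff.2 h)⟩

theorem evalDeformations_toDeformation (F : Finset (Fin n)) {C D : MarkedCurve Δ m}
    (φ : C.graph ≃g D.graph) (he : ∀ i, φ (C.endVertex i) = D.endVertex i)
    (hm : ∀ j, φ (C.markVertex j) = D.markVertex j)
    (hφ : ∀ v w, C.graph.Adj v w → D.dir (φ v) (φ w) = C.dir v w) :
    C.evalDeformations F (toDeformation φ hφ) = ev F D := by
  refine Prod.ext (funext fun j => ?_) (funext fun i => ?_)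
  · exact congrArg D.pos (hm j)
  · exact congrArg (fun v => Submodule.Quotient.mk (D.pos v)) (he i.1)

theorem sameType_refl (C : MarkedCurve Δ m) : C.SameType C :=
  ⟨SimpleGraph.Iso.refl, fun _ => rfl, fun _ => rfl, fun _ _ _ => rfl⟩

theorem isContractionOf_refl (C : MarkedCurve Δ m) : C.IsContractionOf C := by
  refine ⟨id, fun _ => rfl, fun _ => rfl, fun v => ?_, fun v w h => Or.inr ⟨h, rfl⟩,
    fun v w h => ⟨v, w, h, rfl, rfl⟩⟩
  rw [Set.preimage_id]
  have : Nonempty ({v} : Set (Fin C.card)) := ⟨⟨v, rfl⟩⟩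
  exact ⟨fun a b => by rw [Subsingleton.elim a b]⟩

/-- On the cell of a curve that meets conditions in general position, the image of the evaluation
map has the maximal dimension. -/
theorem le_finrank_range_evalDeformations {F : Finset (Fin n)} {M : Set (MarkedCurve Δ m)}
    {P : Conditions Δ F m} (hP : InGeneralPosition F M P) {C : MarkedCurve Δ m} (hC : C ∈ M)
    (hev : ev F C = P) :
    2 * m + F.card ≤ Module.finrank ℝ (LinearMap.range (C.evalDeformations F)) := by
  by_contra! hlt
  -- If the rank were smaller, the image of the cell of `C`, which lies in the linear range, would
  -- be too small to be allowed to contain `P`.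
  refine hP C hC (lt_of_le_of_lt (Submodule.finrank_mono ?_) hlt) ⟨C, ⟨hC, C.sameType_refl⟩, hev⟩
  have hsub : ev F '' {D | D ∈ M ∧ C.SameType D} ⊆
      (LinearMap.range (C.evalDeformations F) : Set (Conditions Δ F m)) := by
    rintro _ ⟨D, ⟨-, φ, he, hm, hφ⟩, rfl⟩
    exact ⟨_, evalDeformations_toDeformation F φ he hm hφ⟩
  rw [vectorSpan_def, Submodule.span_le]
  rintro _ ⟨x, hx, y, hy, rfl⟩
  exact Submodule.sub_mem _ (hsub hx) (hsub hy)

/-- The rank hypothesis makes evaluation surjective, so some deformation separates the images of any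
two markings. Markings at a common vertex always have the same image. -/
theorem markVertex_injective {F : Finset (Fin n)} (hΔ : ∀ i, Δ i ≠ 0) {C : MarkedCurve Δ m}
    (hC : 2 * m + F.card ≤ Module.finrank ℝ (LinearMap.range (C.evalDeformations F))) :
    Function.Injective C.markVertex := by
  intro i j hij
  by_contra hne
  have htop : LinearMap.range (C.evalDeformations F) = ⊤ := by
    by_contra hlt
    have := Submodule.finrank_lt hlt
    rw [finrank_conditions hΔ] at this
    omega
  have hmem : ((Pi.single i (1, 0), 0) : Conditions Δ F m) ∈
      LinearMap.range (C.evalDeformations F) := htop ▸ Submodule.mem_top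
  obtain ⟨x, hx⟩ := hmem
  have h1 : x.1.1 (C.markVertex i) = (1, 0) := by
    have h := congrFun (congrArg Prod.fst hx) i
    rwa [show ((Pi.single i (1, 0), 0) : Conditions Δ F m).1 i = (1, 0) from
      Pi.single_eq_same _ _] at h
  have h2 : x.1.1 (C.markVertex j) = 0 := by
    have h := congrFun (congrArg Prod.fst hx) j
    rwa [show ((Pi.single i (1, 0), 0) : Conditions Δ F m).1 j = 0 from
      Pi.single_eq_of_ne (Ne.symm hne) _] at h
  rw [hij, h2] at h1
  simp [Prod.ext_iff] at h1

/-- Curves of the same combinatorial type are isomorphic if they meet the same conditions and the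
evaluation map is injective on their deformations. -/
theorem isomorphic_of_evalDeformations_injective {F : Finset (Fin n)} {C D : MarkedCurve Δ m}
    (hinj : Function.Injective (C.evalDeformations F)) (h : C.SameType D)
    (hev : ev F C = ev F D) : C.Isomorphic D := by
  obtain ⟨φ, he, hm, hφ⟩ := h
  have h1 := evalDeformations_toDeformation F φ he hm hφ
  -- Both `D` and `C` itself are read as deformations of `C`. They have equal evaluation, so
  -- positions and lengths agree.
  have h2 := evalDeformations_toDeformation F (SimpleGraph.Iso.refl (G := C.graph))
    (fun _ => rfl) (fun _ => rfl) (fun _ _ _ => rfl)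
  have h3 := congrArg Subtype.val (hinj ((h1.trans hev.symm).trans h2.symm))
  refine ⟨φ, he, hm, fun v w hvw => ?_, fun v => congrFun (congrArg Prod.fst h3) v⟩
  exact congrFun (congrArg Prod.snd h3) ⟨s(v, w), hvw⟩

/-! ### Finiteness of the set of combinatorial types. -/

/-- The labelled tree underlying a curve. -/
def labelledTree (C : MarkedCurve Δ m) :
    Σ k : ℕ, SimpleGraph (Fin k) × (Fin n → Fin k) × (Fin m → Fin k) :=
  ⟨C.card, C.graph, C.endVertex, C.markVertex⟩

theorem sameType_of_labelledTree_eq {C D : MarkedCurve Δ m}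
    (h : C.labelledTree = D.labelledTree) : C.SameType D := by
  -- Stated for arbitrary tuples so that the equality can be substituted despite the dependent
  -- vertex sets.
  have key : ∀ x y : Σ k : ℕ, SimpleGraph (Fin k) × (Fin n → Fin k) × (Fin m → Fin k), x = y →
      ∃ φ : x.2.1 ≃g y.2.1, (∀ i, φ (x.2.2.1 i) = y.2.2.1 i) ∧
        ∀ j, φ (x.2.2.2 j) = y.2.2.2 j := by
    rintro x _ rfl
    exact ⟨SimpleGraph.Iso.refl, fun _ => rfl, fun _ => rfl⟩
  obtain ⟨φ, he, hm⟩ := key _ _ h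
  exact ⟨φ, he, hm, fun v w hvw => dir_eq_of_iso (C := C) (D := D) φ he hvw⟩

theorem finite_range_labelledTree (Δ : Fin n → ℤ × ℤ) (m : ℕ) :
    (Set.range (labelledTree : MarkedCurve Δ m → _)).Finite := by
  let T := Σ k : Fin (n + m + 1), SimpleGraph (Fin k) × (Fin n → Fin k) × (Fin m → Fin k)
  let g : T → Σ k : ℕ, SimpleGraph (Fin k) × (Fin n → Fin k) × (Fin m → Fin k) :=
    fun x => ⟨x.1, x.2⟩
  refine (Set.finite_range g).subset ?_
  rintro _ ⟨C, rfl⟩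
  exact ⟨⟨⟨C.card, Nat.lt_succ_of_le C.card_le⟩, C.graph, C.endVertex, C.markVertex⟩, rfl⟩

end MarkedCurve

/-! ### Refined descendant curves through conditions in general position, and their counts. -/

section Refined

variable {n r s : ℕ} {Δ : Fin n → ℤ × ℤ} {F : Finset (Fin n)}

theorem IsRefinedDescendant.mem_descComplex {C : MarkedCurve Δ (r + s)}
    (hC : IsRefinedDescendant C) : C ∈ descComplex r s Δ :=
  ⟨C, hC, C.isContractionOf_refl⟩

/-- With distinct marked vertices the fibre count is the indicator of carrying a complex marking. In
this form the bound can be summed over all vertices. -/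
theorem IsRefinedDescendant.three_add_le_valence {C : MarkedCurve Δ (r + s)}
    (hC : IsRefinedDescendant C) (hinj : Function.Injective C.markVertex) (v : Fin C.card) :
    3 + (Finset.univ.filter fun j : Fin s => C.markVertex (Fin.natAdd r j) = v).card
      ≤ C.valence v := by
  by_cases h : ∃ j : Fin s, C.markVertex (Fin.natAdd r j) = v
  · obtain ⟨j, rfl⟩ := h
    rw [hC.2 j]
    have : (Finset.univ.filter fun i : Fin s =>
        C.markVertex (Fin.natAdd r i) = C.markVertex (Fin.natAdd r j)).card ≤ 1 := by
      rw [Finset.card_le_one]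
      simp only [Finset.mem_filter, Finset.mem_univ, true_and]
      intro a ha b hb
      exact Fin.natAdd_injective s r (hinj (ha.trans hb.symm))
    omega
  · push Not at h
    rw [Finset.filter_false_of_mem fun j _ => h j]
    exact C.three_le_valence v

theorem sum_card_complex_markings (C : MarkedCurve Δ (r + s)) :
    ∑ v, (3 + (Finset.univ.filter fun j : Fin s => C.markVertex (Fin.natAdd r j) = v).card)
      = 3 * C.card + s := by
  rw [Finset.sum_add_distrib, ← Finset.card_eq_sum_card_fiberwise
    (f := fun j : Fin s => C.markVertex (Fin.natAdd r j)) (s := Finset.univ) (by simp)]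
  simp [mul_comm]

theorem IsRefinedDescendant.card_edgeFinset_le {C : MarkedCurve Δ (r + s)}
    (hC : IsRefinedDescendant C) (hdim : r + 2 * s + F.card + 1 = n)
    (hinj : Function.Injective C.markVertex) :
    2 + C.graph.edgeFinset.card ≤ 2 * (r + s) + F.card := by
  -- Summing yields `3V + s ≤ 2E + n + r + s`. With `V = E + 1` and the value of `n` from `hdim`,
  -- this is the claim.
  have h1 := Finset.sum_le_sum fun v (_ : v ∈ Finset.univ) => hC.three_add_le_valence hinj v
  rw [sum_card_complex_markings, C.sum_valence] at h1
  have h2 := C.card_edgeFinset_add_one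
  omega

/-- The hypothesis `hE` makes the edge bound sharp, so no vertex can exceed its minimal valence. -/
theorem IsRefinedDescendant.valence_eq_three {C : MarkedCurve Δ (r + s)}
    (hC : IsRefinedDescendant C) (hdim : r + 2 * s + F.card + 1 = n)
    (hinj : Function.Injective C.markVertex)
    (hE : 2 * (r + s) + F.card ≤ 2 + C.graph.edgeFinset.card) {v : Fin C.card}
    (hv : C.Unmarked v) : C.valence v = 3 := by
  by_contra hne
  have h0 : 3 + (Finset.univ.filter fun j : Fin s => C.markVertex (Fin.natAdd r j) = v).card
      < C.valence v := by
    rw [Finset.filter_false_of_mem fun j _ => hv _]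
    exact lt_of_le_of_ne (C.three_le_valence v) (Ne.symm hne)
  have h1 := Finset.sum_lt_sum (fun v (_ : v ∈ Finset.univ) => hC.three_add_le_valence hinj v)
    ⟨v, Finset.mem_univ v, h0⟩
  rw [sum_card_complex_markings, C.sum_valence] at h1
  have h2 := C.card_edgeFinset_add_one
  omega

variable {P : Conditions Δ F (r + s)}

theorem IsRefinedDescendant.markVertex_injective {C : MarkedCurve Δ (r + s)}
    (hC : IsRefinedDescendant C) (hΔ : ∀ i, Δ i ≠ 0)
    (hP : InGeneralPosition F (descComplex r s Δ) P) (hev : ev F C = P) :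
    Function.Injective C.markVertex :=
  MarkedCurve.markVertex_injective hΔ
    (MarkedCurve.le_finrank_range_evalDeformations hP hC.mem_descComplex hev)

theorem IsRefinedDescendant.unmarked_valence {C : MarkedCurve Δ (r + s)}
    (hC : IsRefinedDescendant C) (hΔ : ∀ i, Δ i ≠ 0) (hdim : r + 2 * s + F.card + 1 = n)
    (hP : InGeneralPosition F (descComplex r s Δ) P) (hev : ev F C = P) {v : Fin C.card}
    (hv : C.Unmarked v) : C.valence v = 3 :=
  hC.valence_eq_three hdim (hC.markVertex_injective hΔ hP hev)
    ((MarkedCurve.le_finrank_range_evalDeformations hP hC.mem_descComplex hev).trans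
      ((LinearMap.finrank_range_le _).trans C.finrank_deformations_le)) hv

/-- Source dimension ≤ `2 + E` ≤ `2(r+s) + |F|` ≤ rank, so the kernel is zero by rank-nullity. -/
theorem IsRefinedDescendant.evalDeformations_injective {C : MarkedCurve Δ (r + s)}
    (hC : IsRefinedDescendant C) (hΔ : ∀ i, Δ i ≠ 0) (hdim : r + 2 * s + F.card + 1 = n)
    (hP : InGeneralPosition F (descComplex r s Δ) P) (hev : ev F C = P) :
    Function.Injective (C.evalDeformations F) := by
  have h1 := MarkedCurve.le_finrank_range_evalDeformations hP hC.mem_descComplex hev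
  have h2 := hC.card_edgeFinset_le hdim (hC.markVertex_injective hΔ hP hev)
  have h3 := C.finrank_deformations_le
  have h4 := LinearMap.finrank_range_add_finrank_ker (C.evalDeformations F)
  rw [← LinearMap.ker_eq_bot, ← Submodule.finrank_eq_zero]
  omega

theorem IsRefinedDescendant.isRefinedBroccoli {C : MarkedCurve Δ (r + s)}
    (hC : IsRefinedDescendant C) (hΔ : ∀ i, Δ i ≠ 0) (hdim : r + 2 * s + F.card + 1 = n)
    (hP : InGeneralPosition F (descComplex r s Δ) P) (hev : ev F C = P) :
    IsRefinedBroccoli C := by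
  intro v
  have hinj := hC.markVertex_injective hΔ hP hev
  by_cases hv : C.Unmarked v
  · exact Or.inr (Or.inl ⟨hC.unmarked_valence hΔ hdim hP hev hv, hv⟩)
  · simp only [MarkedCurve.Unmarked, ne_eq, not_forall, not_not] at hv
    obtain ⟨j, rfl⟩ := hv
    have hu : ∃! k, C.markVertex k = C.markVertex j := ⟨j, rfl, fun k hk => hinj hk⟩
    induction j using Fin.addCases with
    | left i => exact Or.inl ⟨hC.1 i, hu, i, rfl⟩
    | right i => exact Or.inr (Or.inr ⟨hC.2 i, hu, i, rfl⟩)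

/-- General position is not needed here: a marked vertex is not of type (II'), and uniqueness of its
marking tells (I') from (III'). -/
theorem IsRefinedBroccoli.isRefinedDescendant {C : MarkedCurve Δ (r + s)}
    (hC : IsRefinedBroccoli C) : IsRefinedDescendant C := by
  have hne : ∀ (i : Fin r) (k : Fin s), Fin.castAdd s i ≠ Fin.natAdd r k := by
    intro i k h
    have := congrArg Fin.val h
    simp at this
    omega
  constructor
  · intro i
    rcases hC (C.markVertex (Fin.castAdd s i)) with h | h | ⟨-, hu, k, hk⟩
    · exact h.1
    · exact (h.2 _ rfl).elim
    · exact (hne i k (hu.unique rfl hk)).elim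
  · intro k
    rcases hC (C.markVertex (Fin.natAdd r k)) with ⟨-, hu, i, hi⟩ | h | h
    · exact (hne i k (hu.unique hi rfl)).elim
    · exact (h.2 _ rfl).elim
    · exact h.1

theorem isDescendant_append_iff {C : MarkedCurve Δ (r + s)} :
    C.IsDescendant (Fin.append (fun _ : Fin r => 0) (fun _ : Fin s => 1)) ↔
      (∀ v, C.Unmarked v → C.valence v = 3) ∧ IsRefinedDescendant C := by
  simp [MarkedCurve.IsDescendant, IsRefinedDescendant, Fin.forall_fin_add]

/-- The identity holds curve by curve: marked vertices contribute 1, and the end factors depend only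
on `Δ` and `F`, so they can later leave the sum over curves. -/
theorem hasValueAtOne_refinedMult (hΔ : ∀ i, Δ i ≠ 0) (C : MarkedCurve Δ (r + s)) :
    HasValueAtOne (refinedMult F C)
      (C.descMult * ((∏ i ∈ F.filter (fun i => Odd (weight (Δ i))), (weight (Δ i) : ℚ)) /
        (∏ i ∈ Fᶜ.filter (fun i => Odd (weight (Δ i))), (weight (Δ i) : ℚ)))) := by
  refine HasValueAtOne.mul ?_ ?_
  · rw [MarkedCurve.descMult, Finset.prod_filter, Nat.cast_prod]
    refine HasValueAtOne.prod _ fun v _ => ?_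
    by_cases h2 : IsTypeII C v
    · have h3 : C.valence v = 3 ∧ C.Unmarked v := h2
      rw [vertexMult, if_pos h2, if_pos h3]
      exact hasValueAtOne_sub_div_sub _
    · have h3 : ¬ (C.valence v = 3 ∧ C.Unmarked v) := h2
      rw [vertexMult, if_neg h2, if_neg h3, Nat.cast_one]
      split_ifs
      · exact hasValueAtOne_add_div_add _
      · exact hasValueAtOne_one
  · rw [div_eq_mul_inv, ← Finset.prod_inv_distrib, Finset.prod_filter, Finset.prod_filter,
      ← Finset.prod_mul_prod_compl F (fun i => endMult (i ∈ F) (weight (Δ i)))]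
    refine HasValueAtOne.mul (HasValueAtOne.prod _ fun i hi => ?_)
      (HasValueAtOne.prod _ fun i hi => ?_)
    · exact hasValueAtOne_endMult_fixed hi _
    · exact hasValueAtOne_endMult_free (Finset.mem_compl.1 hi) (weight_ne_zero (hΔ i))

theorem weightPow_fixedWeights_ne_zero (hΔ : ∀ i, Δ i ≠ 0) :
    weightPow (fixedWeights Δ F) ≠ 0 := by
  refine finprod_induction (p := fun k : ℕ => k ≠ 0) one_ne_zero (fun _ _ => mul_ne_zero) ?_
  intro i
  rcases eq_or_ne i 0 with rfl | hi
  · have : fixedWeights Δ F 0 = 0 := by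
      simp [fixedWeights, weight_ne_zero (hΔ _)]
    simp [this]
  · exact pow_ne_zero _ hi

/-- The labelled tree determines the curve: equal trees give equal types, and evaluation is
injective on a type. Only finitely many trees occur. -/
theorem finite_refinedDescendant (hΔ : ∀ i, Δ i ≠ 0) (hdim : r + 2 * s + F.card + 1 = n)
    (hP : InGeneralPosition F (descComplex r s Δ) P) :
    {c : Moduli Δ (r + s) | IsRefinedDescendant c.rep ∧ ev F c.rep = P}.Finite := by
  refine Set.Finite.of_finite_image (f := fun c : Moduli Δ (r + s) => c.rep.labelledTree)
    ((MarkedCurve.finite_range_labelledTree Δ (r + s)).subset ?_) ?_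
  · rintro _ ⟨c, -, rfl⟩
    exact ⟨_, rfl⟩
  · intro c hc d hd hcd
    exact Quotient.out_equiv_out.1 (MarkedCurve.isomorphic_of_evalDeformations_injective
      (hc.1.evalDeformations_injective hΔ hdim hP hc.2)
      (MarkedCurve.sameType_of_labelledTree_eq hcd) (hc.2.trans hd.2.symm))

theorem setOf_isRefinedBroccoli_eq (hΔ : ∀ i, Δ i ≠ 0) (hdim : r + 2 * s + F.card + 1 = n)
    (hP : InGeneralPosition F (descComplex r s Δ) P) :
    {c : Moduli Δ (r + s) | IsRefinedBroccoli c.rep ∧ ev F c.rep = P} =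
      {c | IsRefinedDescendant c.rep ∧ ev F c.rep = P} :=
  Set.ext fun _ => ⟨fun h => ⟨h.1.isRefinedDescendant, h.2⟩,
    fun h => ⟨h.1.isRefinedBroccoli hΔ hdim hP h.2, h.2⟩⟩

theorem setOf_isDescendant_eq (hΔ : ∀ i, Δ i ≠ 0) (hdim : r + 2 * s + F.card + 1 = n)
    (hP : InGeneralPosition F (descComplex r s Δ) P) :
    {c : Moduli Δ (r + s) | c.rep.IsDescendant
        (Fin.append (fun _ : Fin r => 0) (fun _ : Fin s => 1)) ∧ ev F c.rep = P} =
      {c | IsRefinedDescendant c.rep ∧ ev F c.rep = P} :=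
  Set.ext fun _ => ⟨fun h => ⟨(isDescendant_append_iff.1 h.1).2, h.2⟩,
    fun h => ⟨isDescendant_append_iff.2
      ⟨fun _ hv => h.1.unmarked_valence hΔ hdim hP h.2 hv, h.1⟩, h.2⟩⟩

theorem hasValueAtOne_refinedDescendantInvariant (hΔ : ∀ i, Δ i ≠ 0)
    (hdim : r + 2 * s + F.card + 1 = n) (hP : InGeneralPosition F (descComplex r s Δ) P) :
    HasValueAtOne (refinedDescendantInvariant r s Δ F P)
      ((∏ i ∈ F.filter (fun i => Odd (weight (Δ i))), (weight (Δ i) : ℚ)) /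
          (∏ i ∈ Fᶜ.filter (fun i => Odd (weight (Δ i))), (weight (Δ i) : ℚ)) *
        (weightPow (fixedWeights Δ F) : ℚ) *
        tropDescendantInvariant Δ F
          (Fin.append (fun _ : Fin r => 0) (fun _ : Fin s => 1)) P) := by
  have hfin := finite_refinedDescendant hΔ hdim hP
  have hI : (weightPow (fixedWeights Δ F) : ℚ) ≠ 0 :=
    Nat.cast_ne_zero.2 (weightPow_fixedWeights_ne_zero hΔ)
  rw [refinedDescendantInvariant, tropDescendantInvariant, setOf_isDescendant_eq hΔ hdim hP,
    finsum_mem_eq_finite_toFinset_sum _ hfin, finsum_mem_eq_finite_toFinset_sum _ hfin]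
  convert (hasValueAtOne_one_div_natCast (Nat.card_pos (α := labelGroup Δ F)).ne').mul
    (HasValueAtOne.sum hfin.toFinset fun c _ => hasValueAtOne_refinedMult hΔ c.rep) using 1
  -- The common end factor leaves the sum, and `I^α` cancels the normalisation of the descendant
  -- invariant.
  rw [← Finset.sum_mul]
  field_simp

end Refined

end RefinedTropical

theorem lemma3p29 (r s n : ℕ) (Δ : Fin n → ℤ × ℤ) (hΔ : ∀ i, Δ i ≠ 0) (F : Finset (Fin n))
    (hdim : r + 2 * s + F.card + 1 = n) (P : RefinedTropical.Conditions Δ F (r + s))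
    (hP : RefinedTropical.InGeneralPosition F (RefinedTropical.descComplex r s Δ) P) :
    {c : RefinedTropical.Moduli Δ (r + s) |
        RefinedTropical.IsRefinedDescendant c.rep ∧ RefinedTropical.ev F c.rep = P}.Finite ∧
    RefinedTropical.HasValueAtOne (RefinedTropical.refinedDescendantInvariant r s Δ F P)
      ((∏ i ∈ F.filter (fun i => Odd (RefinedTropical.weight (Δ i))),
            (RefinedTropical.weight (Δ i) : ℚ)) /
          (∏ i ∈ Fᶜ.filter (fun i => Odd (RefinedTropical.weight (Δ i))),
            (RefinedTropical.weight (Δ i) : ℚ)) *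
        (RefinedTropical.weightPow (RefinedTropical.fixedWeights Δ F) : ℚ) *
        RefinedTropical.tropDescendantInvariant Δ F
          (Fin.append (fun _ : Fin r => 0) (fun _ : Fin s => 1)) P) ∧
    RefinedTropical.HasValueAtOne (RefinedTropical.refinedBroccoliInvariant r s Δ F P)
      ((∏ i ∈ F.filter (fun i => Odd (RefinedTropical.weight (Δ i))),
            (RefinedTropical.weight (Δ i) : ℚ)) /
          (∏ i ∈ Fᶜ.filter (fun i => Odd (RefinedTropical.weight (Δ i))),
            (RefinedTropical.weight (Δ i) : ℚ)) *
        (RefinedTropical.weightPow (RefinedTropical.fixedWeights Δ F) : ℚ) *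
        RefinedTropical.tropDescendantInvariant Δ F
          (Fin.append (fun _ : Fin r => 0) (fun _ : Fin s => 1)) P) := by
  have h := RefinedTropical.hasValueAtOne_refinedDescendantInvariant hΔ hdim hP
  refine ⟨RefinedTropical.finite_refinedDescendant hΔ hdim hP, h, ?_⟩
  rwa [RefinedTropical.refinedBroccoliInvariant,
    RefinedTropical.setOf_isRefinedBroccoli_eq hΔ hdim hP]
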